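/- Let $n$ and $k$ be integers with $n\ge 5$ and $1\le k\le \sqrt{n}$. For a complex character $\chi$ of a finite group $G$, the covering number of $\chi$ is the least positive integer $r$ (if one exists) such that every complex irreducible character of $G$ is a constituent of $\chi^r$. Let $\sigma_{(n-k,k)}=\operatorname{Ind}_{S_{n-k}\times S_k}^{S_n}\mathbb{1}$ be the character of $S_n$ induced from the trivial character of the Young subgroup $S_{n-k}\times S_k$. Then the covering number of $\sigma_{(n-k,k)}$ exists and equals $$\left\lceil \frac{2(n-1)}{k+1}\right\rceil .$$ -/

import Mathlib

noncomputable section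

/-- `Irr(G)`: the set of complex irreducible characters of `G`, as functions on `G`.
(Every finite-dimensional complex representation is equivalent to one on some `Fin d → ℂ`, so
letting `V` range over `Type` loses nothing.) -/
def irreducibleCharacters (G : Type*) [Group G] : Set (G → ℂ) :=
  {χ | ∃ (V : Type) (_ : AddCommGroup V) (_ : Module ℂ V) (_ : FiniteDimensional ℂ V)
    (ρ : Representation ℂ G V), ρ.IsIrreducible ∧ ρ.character = χ}

/-- The form `⟨f, h⟩ = |G|⁻¹ ∑ f(g) h(g⁻¹)` on functions on a finite group `G`. -/
def characterInner {G : Type*} [Group G] [Fintype G] (f h : G → ℂ) : ℂ :=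
  (Fintype.card G : ℂ)⁻¹ * ∑ g : G, f g * h g⁻¹

/-- `c(χ)`: the set of irreducible constituents of a character `χ`, i.e. the irreducible characters
whose multiplicity `⟨χ, ψ⟩` in `χ` is non-zero. -/
def irreducibleConstituents {G : Type*} [Group G] [Fintype G] (χ : G → ℂ) : Set (G → ℂ) :=
  {ψ | ψ ∈ irreducibleCharacters G ∧ characterInner χ ψ ≠ 0}

/-- `r` is the covering number of the character `χ`: the least positive integer such that every
irreducible character of `G` is a constituent of the (pointwise) power `χ ^ r`. -/
def IsCoveringNumber {G : Type*} [Group G] [Fintype G] (χ : G → ℂ) (r : ℕ) : Prop :=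
  IsLeast {m : ℕ | 0 < m ∧ irreducibleConstituents (χ ^ m) = irreducibleCharacters G} r

/-- The Young subgroup `S_{n-k} × S_k` of `S_n`: the image of
`Perm {i | i < n - k} × Perm {i | ¬ i < n - k}` in `Perm (Fin n)`. -/
def twoRowYoungSubgroup (n k : ℕ) : Subgroup (Equiv.Perm (Fin n)) :=
  (Equiv.Perm.subtypeCongrHom fun i : Fin n => (i : ℕ) < n - k).range

/-- The character `σ_{(n-k,k)}` of `S_n` induced from the trivial character of `S_{n-k} × S_k`. -/
def twoRowPermCharacter (n k : ℕ) : Equiv.Perm (Fin n) → ℂ :=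
  (Representation.ind (twoRowYoungSubgroup n k).subtype
    (Representation.trivial ℂ (twoRowYoungSubgroup n k) ℂ)).character

end

/-!
The character `σ` induced from the trivial character of `S_{n-k} × S_k` is the permutation character
on the `k`-subsets of `Fin n`, so `σ ^ m` is the permutation character on `m`-tuples of `k`-subsets.
The stabilizer of such a tuple consists of the permutations that preserve each of the sets. If the
sets separate the points of `Fin n` it is trivial, and a point with trivial stabilizer forces every
irreducible character to occur (`characterInner_card_fixedBy_ne_zero`). If they do not, it contains
a transposition, and when this holds for every tuple the sign character does not occur
(`characterInner_card_fixedBy_sign`). Hence the covering number is the least `m` for which some `m`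
subsets of size `k` separate `n` points
(`irreducibleConstituents_twoRowPermCharacter_pow_eq_iff`).

For separating families, at most one point lies in no set and at most `m` points lie in exactly one,
so counting incidences gives `m k ≥ 2 (n - 1) - m`, that is `m (k + 1) ≥ 2 (n - 1)`
(`two_mul_card_sub_one_le_of_separates`).

Conversely, `m` separating `k`-sets on `n` points are dually a family of `n` distinct subsets of an
`m`-element set in which every point has degree `k`. When `m (k + 1) ≥ 2 (n - 1)`, the empty set,
the singletons and some pairs give `n` distinct sets of total size at most `m k`
(`exists_card_eq_sum_card_le`). Adding points to members one at a time brings the total to exactly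
`m k` (`exists_card_eq_sum_card_eq`), and exchanging one point for another in members, as long as
this evens out the degrees, makes all degrees equal
(`exists_card_eq_forall_card_filter_mem_eq`). The hypothesis `k ^ 2 ≤ n` is what provides enough
pairs and enough members for this.
-/

/-! ### Set families with prescribed degrees -/

section SetFamilies

open Finset

variable {α : Type*} [Fintype α] [DecidableEq α]

/-- Double counting of the incidences between points and members of a family. -/
theorem sum_card_filter_mem (F : Finset (Finset α)) :
    ∑ i : α, #{A ∈ F | i ∈ A} = ∑ A ∈ F, #A := by
  simp_rw [card_filter]
  rw [sum_comm]
  refine sum_congr rfl fun A _ => ?_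
  rw [← card_filter, filter_mem_eq_inter, univ_inter]

omit [Fintype α] in
theorem card_filter_mem_insert_erase {F : Finset (Finset α)} {A B : Finset α} (hA : A ∈ F)
    (hB : B ∉ F) (i : α) :
    #{C ∈ insert B (F.erase A) | i ∈ C} + (if i ∈ A then 1 else 0) =
      #{C ∈ F | i ∈ C} + (if i ∈ B then 1 else 0) := by
  have hB' : B ∉ F.erase A := fun h => hB (mem_of_mem_erase h)
  simp_rw [card_filter]
  rw [sum_insert hB', ← add_sum_erase F _ hA]
  ring

omit [Fintype α] in
theorem card_insert_erase_of_mem_of_notMem {F : Finset (Finset α)} {A B : Finset α} (hA : A ∈ F)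
    (hB : B ∉ F) : #(insert B (F.erase A)) = #F := by
  rw [card_insert_of_notMem fun h => hB (mem_of_mem_erase h), card_erase_add_one hA]

omit [Fintype α] in
/-- If more members of a family contain `u` than contain `v`, then some member can have its
element `u` exchanged for `v` without producing another member: otherwise the transposition
`(u v)` would inject the members containing `u` into those containing `v`. -/
theorem exists_map_swap_notMem {F : Finset (Finset α)} {u v : α}
    (h : #{A ∈ F | v ∈ A} < #{A ∈ F | u ∈ A}) :
    ∃ A ∈ F, u ∈ A ∧ v ∉ A ∧ A.map (Equiv.swap u v).toEmbedding ∉ F := by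
  by_contra! hcon
  refine h.not_ge (card_le_card_of_injOn (fun A => A.map (Equiv.swap u v).toEmbedding) ?_
    fun A _ B _ hAB => map_injective _ hAB)
  intro A hA
  obtain ⟨hAF, huA⟩ := mem_filter.1 hA
  refine mem_filter.2 ⟨?_, mem_map.2 ⟨u, huA, by simp⟩⟩
  by_cases hvA : v ∈ A
  · convert hAF using 1
    ext w
    rw [mem_map_equiv, Equiv.symm_swap, Equiv.swap_apply_def]
    split_ifs <;> simp_all
  · exact hcon A hAF huA hvA

/-- A family whose average degree is the integer `k` can be rearranged, keeping its size, so that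
every point has degree `k`: a rearrangement minimising the sum of the squares of the degrees has
all degrees within `1` of each other. -/
theorem exists_card_eq_forall_card_filter_mem_eq {F : Finset (Finset α)} {k : ℕ}
    (hF : ∑ A ∈ F, #A = Fintype.card α * k) :
    ∃ F' : Finset (Finset α), #F' = #F ∧ ∀ i, #{A ∈ F' | i ∈ A} = k := by
  obtain ⟨F', hF', hmin⟩ := exists_min_image
    ({F' | #F' = #F ∧ ∑ A ∈ F', #A = Fintype.card α * k} : Finset (Finset (Finset α)))
    (fun F' => ∑ i, #{A ∈ F' | i ∈ A} ^ 2) ⟨F, by simp [hF]⟩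
  obtain ⟨hcard, hsum⟩ := (mem_filter.1 hF').2
  have hbal : ∀ u v, #{A ∈ F' | u ∈ A} ≤ #{A ∈ F' | v ∈ A} + 1 := by
    intro u v
    by_contra! hlt
    obtain ⟨A, hA, huA, hvA, hB⟩ := exists_map_swap_notMem ((Nat.lt_succ_self _).trans hlt)
    set B := A.map (Equiv.swap u v).toEmbedding
    have huv : u ≠ v := fun h => hvA (h ▸ huA)
    have hmemB : ∀ w, w ∈ B ↔ Equiv.swap u v w ∈ A := fun w => by
      rw [mem_map_equiv, Equiv.symm_swap]
    have hdeg := card_filter_mem_insert_erase hA hB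
    have hu := hdeg u
    have hv := hdeg v
    simp only [hmemB, Equiv.swap_apply_left, Equiv.swap_apply_right, huA, hvA, if_true,
      if_false] at hu hv
    have hw : ∀ w ∈ (univ.erase u).erase v,
        #{C ∈ insert B (F'.erase A) | w ∈ C} = #{C ∈ F' | w ∈ C} := by
      intro w hw
      obtain ⟨hwv, hwu⟩ : w ≠ v ∧ w ≠ u := by simpa using hw
      simpa only [hmemB, Equiv.swap_apply_of_ne_of_ne hwu hwv, Nat.add_right_cancel_iff]
        using hdeg w
    -- The exchange lowers the degree of `u` by one, raises that of `v` by one and changes no other,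
    -- so it keeps the total size and strictly decreases the sum of squares.
    have hle := hmin (insert B (F'.erase A)) (mem_filter.2 ⟨mem_univ _, by
      rw [card_insert_erase_of_mem_of_notMem hA hB, hcard], by
      rw [← hsum, sum_insert fun h => hB (mem_of_mem_erase h), ← add_sum_erase F' _ hA,
        card_map]⟩)
    have hvu : v ∈ univ.erase u := by simp [huv.symm]
    rw [← add_sum_erase univ _ (mem_univ u), ← add_sum_erase univ _ (mem_univ u),
      ← add_sum_erase _ _ hvu, ← add_sum_erase _ _ hvu,
      sum_congr rfl fun w h => congrArg (· ^ 2) (hw w h)] at hle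
    nlinarith
  refine ⟨F', hcard, fun i => ?_⟩
  rw [← sum_card_filter_mem, ← smul_eq_mul, ← card_univ, ← sum_const] at hsum
  by_contra hne
  rcases Nat.lt_or_gt_of_ne hne with hlt | hgt
  · exact hsum.not_lt (sum_lt_sum (fun j _ => by have := hbal j i; lia) ⟨i, mem_univ i, hlt⟩)
  · exact hsum.not_gt (sum_lt_sum (fun j _ => by have := hbal i j; lia) ⟨i, mem_univ i, hgt⟩)

/-- A family of more than `2 (k - 1)` sets whose average degree is at most `k` can be enlarged to
average degree exactly `k` without changing the number of sets. As long as some point `i` lies in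
fewer than `k` members, more members avoid `i` than contain it, so `i` can be added to one of them
without producing another member. -/
theorem exists_card_eq_sum_card_eq {F : Finset (Finset α)} {k : ℕ} (hk : 2 * (k - 1) < #F)
    (hF : ∑ A ∈ F, #A ≤ Fintype.card α * k) :
    ∃ F' : Finset (Finset α), #F' = #F ∧ ∑ A ∈ F', #A = Fintype.card α * k := by
  obtain ⟨F', hF', hmax⟩ := exists_max_image
    ({F' | #F' = #F ∧ ∑ A ∈ F', #A ≤ Fintype.card α * k} : Finset (Finset (Finset α)))
    (fun F' => ∑ A ∈ F', #A) ⟨F, by simp [hF]⟩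
  obtain ⟨hcard, hsum⟩ := (mem_filter.1 hF').2
  refine ⟨F', hcard, hsum.antisymm ?_⟩
  by_contra! hlt
  obtain ⟨i, hi⟩ : ∃ i, #{A ∈ F' | i ∈ A} < k := by
    by_contra! h
    rw [← sum_card_filter_mem, ← smul_eq_mul, ← card_univ, ← sum_const] at hlt
    exact hlt.not_ge (sum_le_sum fun i _ => h i)
  obtain ⟨A, hA, hiA, hB⟩ : ∃ A ∈ F', i ∉ A ∧ insert i A ∉ F' := by
    by_contra! h
    have hle : #{A ∈ F' | i ∉ A} ≤ #{A ∈ F' | i ∈ A} := by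
      refine card_le_card_of_injOn (insert i) (fun A hA => ?_) fun A hA B hB hAB => ?_
      · obtain ⟨h1, h2⟩ := mem_filter.1 hA
        exact mem_filter.2 ⟨h A h1 h2, mem_insert_self i A⟩
      · rw [← erase_insert (mem_filter.1 hA).2, hAB, erase_insert (mem_filter.1 hB).2]
    have := card_filter_add_card_filter_not (s := F') (fun A => i ∈ A)
    lia
  have h1 : ∑ C ∈ insert (insert i A) (F'.erase A), #C = ∑ C ∈ F', #C + 1 := by
    rw [sum_insert fun h => hB (mem_of_mem_erase h), ← add_sum_erase F' _ hA,
      card_insert_of_notMem hiA]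
    ring
  have := hmax (insert (insert i A) (F'.erase A)) (mem_filter.2 ⟨mem_univ _, by
    rw [card_insert_erase_of_mem_of_notMem hA hB, hcard], by lia⟩)
  lia

theorem filter_card_le_one_eq :
    ({A : Finset α | #A ≤ 1} : Finset (Finset α)) =
      powersetCard 0 univ ∪ powersetCard 1 univ := by
  ext A
  simp only [mem_filter, mem_univ, true_and, mem_union, mem_powersetCard_univ]
  lia

theorem card_filter_card_le_one : #{A : Finset α | #A ≤ 1} = 1 + Fintype.card α := by
  rw [filter_card_le_one_eq, card_union_of_disjoint ((pairwise_disjoint_powersetCard _) zero_ne_one)]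
  simp [card_powersetCard]

theorem card_filter_card_le_two :
    #{A : Finset α | #A ≤ 2} = 1 + Fintype.card α + (Fintype.card α).choose 2 := by
  have h : ({A : Finset α | #A ≤ 2} : Finset (Finset α)) =
      ({A : Finset α | #A ≤ 1} : Finset (Finset α)) ∪ powersetCard 2 univ := by
    ext A
    simp only [mem_filter, mem_univ, true_and, mem_union, mem_powersetCard_univ]
    lia
  rw [h, card_union_of_disjoint, card_filter_card_le_one]
  · simp [card_powersetCard]
  · refine disjoint_left.2 fun A hA hA' => ?_
    have h1 := (mem_filter.1 hA).2
    have h2 := (mem_powersetCard.1 hA').2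
    lia

theorem sum_card_filter_card_le_one :
    ∑ A : Finset α with #A ≤ 1, #A = Fintype.card α := by
  rw [filter_card_le_one_eq, sum_union ((pairwise_disjoint_powersetCard _) zero_ne_one), powersetCard_zero,
    sum_singleton, card_empty, sum_congr rfl fun A hA => (mem_powersetCard.1 hA).2]
  simp

/-- Taking the empty set, the singletons and then pairs gives `n` distinct subsets of `α` of
average degree at most `k`. -/
theorem exists_card_eq_sum_card_le {n k : ℕ} (hk : 1 ≤ k) (hkα : k ≤ Fintype.card α)
    (h : 2 * (n - 1) ≤ Fintype.card α * (k + 1)) :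
    ∃ F : Finset (Finset α), #F = n ∧ ∑ A ∈ F, #A ≤ Fintype.card α * k := by
  set r := Fintype.card α with hr
  rcases le_total n (1 + r) with hn | hn
  · rw [hr, ← card_filter_card_le_one] at hn
    obtain ⟨F, hF, rfl⟩ := exists_subset_card_eq hn
    refine ⟨F, rfl, (sum_le_sum_of_subset hF).trans ?_⟩
    rw [sum_card_filter_card_le_one]
    exact Nat.le_mul_of_pos_right _ hk
  -- There are enough pairs, because `2 (n - 1) ≤ r (k + 1) ≤ r (r + 1)`.
  · have hn2 : n ≤ #{A : Finset α | #A ≤ 2} := by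
      rw [card_filter_card_le_two, ← hr]
      have h1 : 2 * r.choose 2 = r * (r - 1) := by
        rw [Nat.choose_two_right, Nat.mul_div_cancel' (Nat.even_mul_pred_self r).two_dvd]
      obtain ⟨s, hs⟩ : ∃ s, r = s + 1 := ⟨r - 1, by lia⟩
      have h2 : r * (k + 1) ≤ r * (r + 1) := by gcongr
      rw [hs] at h1 h2 h hn ⊢
      simp only [Nat.add_sub_cancel] at h1
      have h3 : (s + 1) * (s + 1 + 1) = (s + 1) * s + 2 * (s + 1) := by ring
      lia
    obtain ⟨F, hF1, hF2, rfl⟩ := exists_subsuperset_card_eq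
      (s := ({A : Finset α | #A ≤ 1} : Finset (Finset α))) (t := {A : Finset α | #A ≤ 2})
      (fun A hA => by simp only [mem_filter, mem_univ, true_and] at hA ⊢; lia)
      (by rwa [card_filter_card_le_one]) hn2
    refine ⟨F, rfl, ?_⟩
    rw [← sum_sdiff hF1, sum_card_filter_card_le_one, ← hr]
    have h1 : ∑ A ∈ F \ ({A | #A ≤ 1} : Finset (Finset α)), #A ≤
        #(F \ ({A | #A ≤ 1} : Finset (Finset α))) • 2 :=
      sum_le_card_nsmul _ _ _ fun A hA => (mem_filter.1 (hF2 (mem_sdiff.1 hA).1)).2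
    rw [card_sdiff_of_subset hF1, card_filter_card_le_one, ← hr, smul_eq_mul] at h1
    have h2 : r * (k + 1) = r * k + r := by ring
    lia

end SetFamilies

/-! ### Families of `k`-sets that separate points -/

section SeparatingFamilies

open Finset

/-- A finite family of sets separates points if any two points lying in the same sets are equal. -/
def SeparatesPoints {ι β : Type*} (S : ι → Finset β) : Prop :=
  ∀ x y, (∀ j, x ∈ S j ↔ y ∈ S j) → x = y

/-- If `m` sets of size `k` separate `n` points, then at most one point lies in no set and at most
`m` points lie in exactly one set, so there are at least `2 (n - 1) - m` incidences. -/
theorem two_mul_card_sub_one_le_of_separates {ι β : Type*} [Fintype ι] [Fintype β] {k : ℕ}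
    {S : ι → Finset β} (hS : SeparatesPoints S) (hk : ∀ j, #(S j) = k) :
    2 * (Fintype.card β - 1) ≤ Fintype.card ι * (k + 1) := by
  classical
  set A : β → Finset ι := fun x => {j | x ∈ S j} with hA
  have hinj : Function.Injective A := fun x y h => hS x y fun j => by
    have := congrArg (j ∈ ·) h
    simpa [hA] using this
  have hsum : ∑ x, #(A x) = Fintype.card ι * k := by
    simp_rw [hA, card_filter]
    rw [sum_comm]
    simp_rw [← card_filter, filter_mem_eq_inter, univ_inter, hk]
    simp
  have hcount : ∀ c, #{x | #(A x) = c} ≤ (Fintype.card ι).choose c := fun c => by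
    rw [← card_univ, ← card_powersetCard]
    exact card_le_card_of_injOn A (fun x hx => mem_powersetCard.2
      ⟨subset_univ _, (mem_filter.1 hx).2⟩) hinj.injOn
  have h0 := hcount 0
  have h1 := hcount 1
  rw [Nat.choose_zero_right] at h0
  rw [Nat.choose_one_right] at h1
  -- Every point has weight at least `2`, after a correction for those in at most one set.
  have hle : ∑ _x : β, 2 ≤
      ∑ x, (#(A x) + (if #(A x) = 1 then 1 else 0) + 2 * (if #(A x) = 0 then 1 else 0)) :=
    sum_le_sum fun x _ => by split_ifs <;> lia
  rw [sum_add_distrib, sum_add_distrib, ← mul_sum, ← card_filter, ← card_filter, hsum, sum_const,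
    card_univ, smul_eq_mul] at hle
  have : Fintype.card ι * (k + 1) = Fintype.card ι * k + Fintype.card ι := by ring
  lia

/-- Passing to the dual family, whose members are the sets of indices `j` with `x ∈ S j`, a
separating family of `k`-sets is a family of distinct sets in which all degrees are `k`. -/
theorem exists_separatesPoints {ι β : Type*} [Fintype ι] [Fintype β] {k : ℕ} (hk : 1 ≤ k)
    (hkι : k ≤ Fintype.card ι) (hkβ : 2 * (k - 1) < Fintype.card β)
    (h : 2 * (Fintype.card β - 1) ≤ Fintype.card ι * (k + 1)) :
    ∃ S : ι → Finset β, SeparatesPoints S ∧ ∀ j, #(S j) = k := by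
  classical
  obtain ⟨F, hFcard, hF⟩ := exists_card_eq_sum_card_le hk hkι h
  obtain ⟨F', hF'card, hF'⟩ := exists_card_eq_sum_card_eq (hFcard ▸ hkβ) hF
  obtain ⟨D, hDcard, hD⟩ := exists_card_eq_forall_card_filter_mem_eq hF'
  have e : β ≃ D := Fintype.equivOfCardEq (by rw [Fintype.card_coe, hDcard, hF'card, hFcard])
  refine ⟨fun j => {x | j ∈ (e x : Finset ι)}, fun x y hxy => ?_, fun j => ?_⟩
  · exact e.injective (Subtype.ext (Finset.ext fun j => by simpa using hxy j))
  · rw [← hD j]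
    refine card_bij (fun x _ => (e x : Finset ι)) (fun x hx => ?_) (fun x _ y _ hxy => ?_)
      fun A hA => ?_
    · exact mem_filter.2 ⟨(e x).2, (mem_filter.1 hx).2⟩
    · exact e.injective (Subtype.ext hxy)
    · obtain ⟨h1, h2⟩ := mem_filter.1 hA
      exact ⟨e.symm ⟨A, h1⟩, by simp [h2], by simp⟩

end SeparatingFamilies

/-! ### Induced trivial characters and permutation characters -/

section PermutationCharacters

variable {G : Type*} [Group G]

/-- The representation induced from the trivial representation of `H` is the permutation
representation on `G ⧸ H`: the class of `g ⊗ a` corresponds to `a` times the coset `g⁻¹ H`, the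
inverse turning the left `H`-coinvariants of `ℂ[G]` into functions on left cosets. -/
noncomputable def indTrivialEquiv (H : Subgroup G) :
    Representation.IndV H.subtype (Representation.trivial ℂ H ℂ) ≃ₗ[ℂ] (G ⧸ H →₀ ℂ) :=
  LinearEquiv.ofLinearMap
    (Representation.Coinvariants.lift _
      (TensorProduct.lift ((Finsupp.lift (ℂ →ₗ[ℂ] (G ⧸ H →₀ ℂ)) ℂ G
        fun g => Finsupp.lsingle (QuotientGroup.mk g⁻¹)) ∘ₗ
          (MonoidAlgebra.coeffLinearEquiv ℂ).toLinearMap))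
      fun h => TensorProduct.ext <| MonoidAlgebra.lhom_ext' fun g => LinearMap.ext_ring <|
        LinearMap.ext_ring <| by
          have : (QuotientGroup.mk (g⁻¹ * (h : G)⁻¹) : G ⧸ H) = QuotientGroup.mk g⁻¹ := by
            rw [QuotientGroup.eq]; simp
          simp [this])
    (Finsupp.lsum ℂ fun q : G ⧸ H => Representation.IndV.mk H.subtype _ q.out⁻¹)
    (by
      refine Finsupp.lhom_ext' fun q => LinearMap.ext_ring ?_
      simp)
    (by
      refine Representation.IndV.hom_ext _ _ fun g => LinearMap.ext_ring ?_
      obtain ⟨h, hh⟩ := QuotientGroup.mk_out_eq_mul H g⁻¹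
      have := Representation.Coinvariants.mk_self_apply
        (Representation.tprod ((Representation.leftRegular ℂ G).comp H.subtype)
          (Representation.trivial ℂ H ℂ)) h⁻¹ (MonoidAlgebra.single g 1 ⊗ₜ 1)
      simpa [hh] using this)

@[simp]
theorem indTrivialEquiv_mk (H : Subgroup G) (g : G) (a : ℂ) :
    indTrivialEquiv H (Representation.IndV.mk H.subtype (Representation.trivial ℂ H ℂ) g a) =
      Finsupp.single (QuotientGroup.mk g⁻¹) a := by
  simp [indTrivialEquiv]

theorem character_ind_trivial [Finite G] (H : Subgroup G) (g : G) :
    (Representation.ind H.subtype (Representation.trivial ℂ H ℂ)).character g =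
      Nat.card (MulAction.fixedBy (G ⧸ H) g) := by
  classical
  have := Fintype.ofFinite (G ⧸ H)
  have hconj : (indTrivialEquiv H).conj
      (Representation.ind H.subtype (Representation.trivial ℂ H ℂ) g) =
      Finsupp.lmapDomain ℂ ℂ (g • · : G ⧸ H → G ⧸ H) := by
    have h : (indTrivialEquiv H).toLinearMap ∘ₗ
        Representation.ind H.subtype (Representation.trivial ℂ H ℂ) g =
        Finsupp.lmapDomain ℂ ℂ (g • · : G ⧸ H → G ⧸ H) ∘ₗ (indTrivialEquiv H).toLinearMap := by
      refine Representation.IndV.hom_ext _ _ fun a => LinearMap.ext fun c => ?_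
      change indTrivialEquiv H (Representation.ind H.subtype (Representation.trivial ℂ H ℂ) g
        (Representation.IndV.mk _ _ a c)) = Finsupp.mapDomain (g • ·)
          (indTrivialEquiv H (Representation.IndV.mk _ _ a c))
      rw [Representation.ind_mk, indTrivialEquiv_mk, indTrivialEquiv_mk, Finsupp.mapDomain_single,
        MulAction.Quotient.smul_mk, mul_inv_rev, inv_inv, smul_eq_mul]
    refine LinearMap.ext fun v => ?_
    simpa using LinearMap.congr_fun h ((indTrivialEquiv H).symm v)
  rw [Representation.character, ← LinearMap.trace_conj' _ (indTrivialEquiv H), hconj,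
    LinearMap.trace_eq_matrix_trace ℂ (Finsupp.basisSingleOne (ι := G ⧸ H)), Matrix.trace]
  simp [LinearMap.toMatrix_apply, Finsupp.single_apply, MulAction.fixedBy, Finset.sum_boole,
    Fintype.card_subtype]

/-- The pairing of a permutation character with `f`, computed one point of the set at a time. -/
theorem characterInner_card_fixedBy [Fintype G] {X : Type*} [MulAction G X] [Fintype X]
    [DecidableEq X] (f : G → ℂ) :
    characterInner (fun g => (Nat.card (MulAction.fixedBy X g) : ℂ)) f =
      (Fintype.card G : ℂ)⁻¹ * ∑ x : X, ∑ g : G with g • x = x, f g⁻¹ := by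
  simp_rw [characterInner, Finset.sum_filter]
  rw [Finset.sum_comm]
  congr 1
  refine Finset.sum_congr rfl fun g _ => ?_
  rw [← Finset.sum_filter, Finset.sum_const, nsmul_eq_mul, Nat.card_eq_card_toFinset]
  congr 3
  ext x
  simp

/-- Restricted to a subgroup, a character sums to the order of the subgroup times the dimension of
its space of invariants, which is a natural number. -/
theorem exists_sum_character_inv_eq [Fintype G] {V : Type*} [AddCommGroup V] [Module ℂ V]
    [FiniteDimensional ℂ V] (ρ : Representation ℂ G V) (H : Subgroup G) [DecidablePred (· ∈ H)] :
    ∃ c : ℕ, ∑ g : G with g ∈ H, ρ.character g⁻¹ = c := by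
  let τ : Representation ℂ H V := ρ.comp H.subtype
  have : Invertible (Nat.card H : ℂ) := invertibleOfNonzero (by simp)
  have h := Representation.card_inv_mul_sum_char_eq_finrank τ.dual
  refine ⟨Nat.card H * Module.finrank ℂ (Representation.invariants τ.dual), ?_⟩
  push_cast
  rw [← h, mul_inv_cancel_left₀ (by simp), Finset.sum_subtype (p := (· ∈ H)) _ (by simp)]
  refine Finset.sum_congr rfl fun g _ => ?_
  rw [Representation.char_dual]
  rfl

/-- If `G` acts on `X` with a regular orbit, every irreducible character is a constituent of the
permutation character: each point contributes a non-negative amount, and a point with trivial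
stabilizer contributes the positive degree of the irreducible character. -/
theorem characterInner_card_fixedBy_ne_zero [Fintype G] {X : Type*} [MulAction G X] [Fintype X]
    {x : X} (hx : ∀ g : G, g • x = x → g = 1) {ψ : G → ℂ} (hψ : ψ ∈ irreducibleCharacters G) :
    characterInner (fun g => (Nat.card (MulAction.fixedBy X g) : ℂ)) ψ ≠ 0 := by
  classical
  obtain ⟨V, _, _, _, ρ, hρ, rfl⟩ := hψ
  rw [characterInner_card_fixedBy]
  refine mul_ne_zero (by simp) ?_
  choose c hc using fun y : X => exists_sum_character_inv_eq ρ (MulAction.stabilizer G y)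
  simp only [MulAction.mem_stabilizer_iff] at hc
  simp_rw [hc]
  have hcx : c x ≠ 0 := by
    have h1 : ({g : G | g • x = x} : Finset G) = {1} := by
      ext g
      simp only [Finset.mem_filter, Finset.mem_univ, true_and, Finset.mem_singleton]
      exact ⟨hx g, fun h => by rw [h, one_smul]⟩
    have h2 := hc x
    rw [h1, Finset.sum_singleton, inv_one, Representation.char_one, Nat.cast_inj] at h2
    have : Nontrivial V := by
      by_contra h
      rw [not_nontrivial_iff_subsingleton] at h
      have := hρ.toNontrivial
      exact bot_ne_top (α := Subrepresentation ρ)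
        (Subrepresentation.toSubmodule_injective (Subsingleton.elim _ _))
    rw [← h2]
    exact Module.finrank_pos.ne'
  rw [← Nat.cast_sum, Nat.cast_ne_zero]
  exact fun h => hcx (Finset.sum_eq_zero_iff.1 h x (Finset.mem_univ x))

end PermutationCharacters

/-! ### The sign character -/

section SignCharacter

open Equiv

theorem sign_mem_irreducibleCharacters (α : Type*) [Fintype α] [DecidableEq α] :
    (fun g : Perm α => ((Perm.sign g : ℤ) : ℂ)) ∈ irreducibleCharacters (Perm α) := by
  let ρ : Representation ℂ (Perm α) ℂ :=
    (algebraMap ℂ (Module.End ℂ ℂ)).toMonoidHom.comp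
      ((Int.castRingHom ℂ).toMonoidHom.comp ((Units.coeHom ℤ).comp Perm.sign))
  refine ⟨ℂ, inferInstance, inferInstance, inferInstance, ρ, ?_, ?_⟩
  · have := is_simple_module_of_finrank_eq_one (A := ℂ) (Module.finrank_self ℂ)
    refine { exists_pair_ne := ⟨⊥, ⊤, fun h => ?_⟩, eq_bot_or_eq_top := fun W => ?_ }
    · exact bot_ne_top (α := Submodule ℂ ℂ) (congrArg Subrepresentation.toSubmodule h)
    · exact (eq_bot_or_eq_top W.toSubmodule).imp
        (fun h => Subrepresentation.toSubmodule_injective h)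
        fun h => Subrepresentation.toSubmodule_injective h
  · ext g
    have : ρ g = ((Perm.sign g : ℤ) : ℂ) • (1 : Module.End ℂ ℂ) := by
      rw [← Algebra.algebraMap_eq_smul_one]; rfl
    simp [Representation.character, this]

/-- The sign character is not a constituent of a permutation character all of whose point
stabilizers contain a transposition, since right multiplication by that transposition cancels the
contribution of the point. -/
theorem characterInner_card_fixedBy_sign {α X : Type*} [Fintype α] [DecidableEq α]
    [MulAction (Perm α) X] [Fintype X]
    (h : ∀ x : X, ∃ a b : α, a ≠ b ∧ swap a b • x = x) :
    characterInner (fun g : Perm α => (Nat.card (MulAction.fixedBy X g) : ℂ))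
      (fun g => ((Perm.sign g : ℤ) : ℂ)) = 0 := by
  classical
  rw [characterInner_card_fixedBy, Finset.sum_eq_zero, mul_zero]
  intro x _
  obtain ⟨a, b, hab, hx⟩ := h x
  refine Finset.sum_involution (fun g _ => g * swap a b) ?_ ?_ ?_ ?_
  · intro g _
    simp [Perm.sign_mul, Perm.sign_inv, Perm.sign_swap hab]
  · intro g _ _ hg
    exact hab (swap_eq_one_iff.1 (mul_eq_left.1 hg))
  · intro g hg
    simp only [Finset.mem_filter, Finset.mem_univ, true_and] at hg ⊢
    rw [mul_smul, hx, hg]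
  · intro g _
    simp

end SignCharacter

/-! ### Two-row Young subgroups -/

section TwoRowYoungSubgroups

open Equiv Finset

/-- The `k`-subset of `Fin n` whose setwise stabilizer is the two-row Young subgroup. -/
def lastPoints (n k : ℕ) : Finset (Fin n) := {i | ¬ (i : ℕ) < n - k}

theorem card_lastPoints {n k : ℕ} (h : k ≤ n) : #(lastPoints n k) = k := by
  have h1 := Finset.card_filter_add_card_filter_not (s := (univ : Finset (Fin n)))
    (fun i => (i : ℕ) < n - k)
  rw [Fin.card_filter_val_lt, card_univ, Fintype.card_fin] at h1
  rw [lastPoints]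
  lia

theorem mem_twoRowYoungSubgroup {n k : ℕ} {g : Perm (Fin n)} :
    g ∈ twoRowYoungSubgroup n k ↔ ∀ i, g i ∈ lastPoints n k ↔ i ∈ lastPoints n k := by
  simp only [lastPoints, mem_filter, mem_univ, true_and, not_iff_not]
  constructor
  · rintro ⟨⟨e, f⟩, rfl⟩ i
    rw [Perm.subtypeCongrHom_apply]
    by_cases hi : (i : ℕ) < n - k
    · rw [Perm.subtypeCongr.left_apply e f hi]
      exact iff_of_true (e ⟨i, hi⟩).2 hi
    · rw [Perm.subtypeCongr.right_apply e f hi]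
      exact iff_of_false (f ⟨i, hi⟩).2 hi
  · intro h
    refine ⟨(g.subtypePerm h, g.subtypePerm fun i => not_congr (h i)), ?_⟩
    refine Equiv.ext fun i => ?_
    rw [Perm.subtypeCongrHom_apply, Perm.subtypeCongr.apply]
    split_ifs <;> rfl

/-- The coset `a H` of the two-row Young subgroup stands for the `k`-set `a '' lastPoints n k`, and
`g` fixes the one if and only if it fixes the other. -/
theorem smul_mk_eq_mk_iff {n k : ℕ} {g a : Perm (Fin n)} :
    g • (QuotientGroup.mk a : Perm (Fin n) ⧸ twoRowYoungSubgroup n k) = QuotientGroup.mk a ↔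
      ∀ i, g i ∈ (lastPoints n k).map a.toEmbedding ↔
        i ∈ (lastPoints n k).map a.toEmbedding := by
  rw [MulAction.Quotient.smul_mk, eq_comm, QuotientGroup.eq, mem_twoRowYoungSubgroup,
    a.forall_congr_left]
  simp only [mem_map_equiv]
  simp [Perm.mul_apply, Perm.inv_def]

theorem exists_map_lastPoints_eq {n k : ℕ} {S : Finset (Fin n)} (hk : k ≤ n) (hS : #S = k) :
    ∃ a : Perm (Fin n), (lastPoints n k).map a.toEmbedding = S := by
  let e : {x // x ∈ lastPoints n k} ≃ {x // x ∈ S} :=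
    Finset.equivOfCardEq (by rw [card_lastPoints hk, hS])
  refine ⟨e.extendSubtype, eq_of_subset_of_card_le (fun y hy => ?_) ?_⟩
  · obtain ⟨x, hx, rfl⟩ := mem_map.1 hy
    exact e.extendSubtype_mem x hx
  · rw [card_map, card_lastPoints hk, hS]

/-- The powers of the two-row permutation character are the permutation characters on tuples of
cosets. -/
theorem twoRowPermCharacter_pow (n k m : ℕ) :
    twoRowPermCharacter n k ^ m = fun g : Perm (Fin n) =>
      (Nat.card (MulAction.fixedBy (Fin m → Perm (Fin n) ⧸ twoRowYoungSubgroup n k) g) : ℂ) := by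
  ext g
  rw [Pi.pow_apply, twoRowPermCharacter, character_ind_trivial, ← Nat.cast_pow, Nat.cast_inj]
  have e : MulAction.fixedBy (Fin m → Perm (Fin n) ⧸ twoRowYoungSubgroup n k) g ≃
      (Fin m → MulAction.fixedBy (Perm (Fin n) ⧸ twoRowYoungSubgroup n k) g) :=
    { toFun x j := ⟨x.1 j, congrFun x.2 j⟩
      invFun x := ⟨fun j => (x j).1, funext fun j => (x j).2⟩
      left_inv _ := rfl
      right_inv _ := rfl }
  rw [Nat.card_congr e, Nat.card_fun, Nat.card_fin]

/-- The `m`-th power of the two-row permutation character contains every irreducible character if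
and only if some `m` subsets of size `k` separate the points of `Fin n`. -/
theorem irreducibleConstituents_twoRowPermCharacter_pow_eq_iff {n k m : ℕ} (hk : k ≤ n) :
    irreducibleConstituents (twoRowPermCharacter n k ^ m) =
        irreducibleCharacters (Perm (Fin n)) ↔
      ∃ S : Fin m → Finset (Fin n), SeparatesPoints S ∧ ∀ j, #(S j) = k := by
  classical
  have := Fintype.ofFinite (Perm (Fin n) ⧸ twoRowYoungSubgroup n k)
  rw [twoRowPermCharacter_pow]
  constructor
  · intro h
    by_contra! hS
    refine ((Set.ext_iff.1 h _).2 (sign_mem_irreducibleCharacters (Fin n))).2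
      (characterInner_card_fixedBy_sign fun x => ?_)
    choose a ha using fun j => QuotientGroup.mk_surjective (x j)
    have hns : ¬ SeparatesPoints fun j => (lastPoints n k).map (a j).toEmbedding := fun h => by
      obtain ⟨j, hj⟩ := hS _ h
      exact hj (by rw [card_map, card_lastPoints hk])
    simp only [SeparatesPoints, not_forall] at hns
    obtain ⟨u, v, huv, hne⟩ := hns
    refine ⟨u, v, hne, funext fun j => ?_⟩
    rw [Pi.smul_apply, ← ha j, smul_mk_eq_mk_iff]
    intro i
    have := huv j
    rw [swap_apply_def]
    split_ifs with h1 h2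
    · rw [h1, this]
    · rw [h2, this]
    · rfl
  · rintro ⟨S, hS, hSk⟩
    choose a ha using fun j => exists_map_lastPoints_eq hk (hSk j)
    refine Set.ext fun ψ => ⟨fun h => h.1, fun hψ => ⟨hψ,
      characterInner_card_fixedBy_ne_zero (x := fun j => QuotientGroup.mk (a j))
        (fun g hg => Equiv.ext fun i => hS _ _ fun j => ?_) hψ⟩⟩
    have := smul_mk_eq_mk_iff.1 (congrFun hg j) i
    rwa [ha j] at this

end TwoRowYoungSubgroups

/-! ### The covering number -/

theorem mainTheorem6 (n k : ℕ) (hn : 5 ≤ n) (hk : 1 ≤ k) (hkn : (k : ℝ) ≤ √(n : ℝ)) :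
    IsCoveringNumber (twoRowPermCharacter n k)
      ⌈(2 * ((n : ℝ) - 1)) / ((k : ℝ) + 1)⌉₊ := by
  have hsq : k * k ≤ n := by
    have := (Real.le_sqrt (Nat.cast_nonneg k) (Nat.cast_nonneg n)).1 hkn
    rw [sq] at this
    exact_mod_cast this
  have hkn' : k ≤ n := (Nat.le_mul_self k).trans hsq
  have hceil : ∀ m : ℕ, ⌈(2 * ((n : ℝ) - 1)) / ((k : ℝ) + 1)⌉₊ ≤ m ↔
      2 * (n - 1) ≤ m * (k + 1) := fun m => by
    rw [Nat.ceil_le, div_le_iff₀ (by positivity), ← Nat.cast_pred (by lia)]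
    norm_cast
  set r := ⌈(2 * ((n : ℝ) - 1)) / ((k : ℝ) + 1)⌉₊
  have hrn := (hceil r).1 le_rfl
  -- From `k ^ 2 ≤ n` one gets `r ≥ 2 (k - 1)`, which is at least `k` unless `k = 1`.
  have hkr : k ≤ r := by
    by_contra! hlt
    have h1 : r * (k + 1) ≤ (k - 1) * (k + 1) := by gcongr; lia
    obtain ⟨l, rfl⟩ : ∃ l, k = l + 1 := ⟨k - 1, by lia⟩
    simp only [Nat.add_sub_cancel] at h1
    have h2 : (l + 1) * (l + 1) = l * (l + 1 + 1) + 1 := by ring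
    lia
  refine ⟨⟨by lia, ?_⟩, fun m hm => ?_⟩
  · refine (irreducibleConstituents_twoRowPermCharacter_pow_eq_iff hkn').2
      (exists_separatesPoints hk (by simpa using hkr) ?_ (by simpa using hrn))
    -- `2 (k - 1) < k ^ 2 ≤ n`
    rw [Fintype.card_fin]
    rcases hk.eq_or_lt with rfl | h
    · lia
    · have : 2 * k ≤ k * k := by gcongr; exact h
      lia
  · obtain ⟨S, hS, hSk⟩ :=
      (irreducibleConstituents_twoRowPermCharacter_pow_eq_iff hkn').1 hm.2
    rw [hceil]
    simpa using two_mul_card_sub_one_le_of_separates hS hSk
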